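/- Let $\mathcal{E}$ be an ellipse in the Euclidean plane with center $O$ and semi-axes $a,b>0$, and let $O_c$ be any point in the interior of the ellipse with the same center and axis directions and with semi-axes $a/2,b/2$ (respectively). Then there is a (nondegenerate) ellipse $\mathcal{K}$ centered at $O_c$ and contained in the interior of $\mathcal{E}$, such that $\mathcal{K}$ is the caustic of a Poncelet family of triangles inscribed in $\mathcal{E}$: every point of $\mathcal{E}$ is a vertex of a triangle inscribed in $\mathcal{E}$ whose three sides are tangent to $\mathcal{K}$. Moreover, the barycenter is stationary over this family and lies on the line $OO_c$: there is a point $G$ on the line through $O$ and $O_c$ (to be read as $G=O$ if $O_c=O$) such that every triangle inscribed in $\mathcal{E}$ whose three sides are tangent to $\mathcal{K}$ has barycenter $G$. -/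

import Mathlib

/-- The Euclidean plane. -/
abbrev Plane : Type := EuclideanSpace ℝ (Fin 2)

/-- The ellipse (the curve) with center `O`, axes in the directions of the orthonormal frame `u`,
and semi-axes `a` along `u 0` and `b` along `u 1`. -/
def ellipse (O : Plane) (u : OrthonormalBasis (Fin 2) ℝ Plane) (a b : ℝ) : Set Plane :=
  {p | (inner ℝ (u 0) (p - O) / a) ^ 2 + (inner ℝ (u 1) (p - O) / b) ^ 2 = 1}

/-- The open region bounded by `ellipse O u a b`. -/
def ellipseInterior (O : Plane) (u : OrthonormalBasis (Fin 2) ℝ Plane) (a b : ℝ) : Set Plane :=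
  {p | (inner ℝ (u 0) (p - O) / a) ^ 2 + (inner ℝ (u 1) (p - O) / b) ^ 2 < 1}

/-- The Poncelet triangles of a pair of ellipses `E` (outer) and `K` (caustic): nondegenerate
triangles inscribed in `E` and circumscribed about `K`. A line is tangent to an ellipse iff it
meets it in exactly one point; each side line is tangent to `K`, at a point between the two
vertices. -/
def ponceletTriangles (E K : Set Plane) : Set (Affine.Triangle ℝ Plane) :=
  {T | (∀ i, T.points i ∈ E) ∧
    ∀ i j, i ≠ j → ∃ p ∈ openSegment ℝ (T.points i) (T.points j),
      (line[ℝ, T.points i, T.points j] : Set Plane) ∩ K = {p}}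

/-- `K` is the caustic of a Poncelet family of triangles inscribed in `E`: every point of `E` is a
vertex of a triangle inscribed in `E` and circumscribed about `K`. -/
def AdmitsPonceletTriangles (E K : Set Plane) : Prop :=
  ∀ P ∈ E, ∃ T ∈ ponceletTriangles E K, ∃ i, T.points i = P

/-! An affine map turns the outer ellipse into the unit circle and `Oc` into `h / 2`, where `h = (p,
q)` and `|h| < 1`. A triangle inscribed in the circle has orthocenter `z₁ + z₂ + z₃`. If this equals
`h`, its sides touch the conic with foci at the circumcenter `0` and the orthocenter `h` and major
axis `1`; that conic has center `h / 2` and pulls back to the caustic.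

Existence: each `z₁` on the circle extends to such a triangle, and the focal form is a perfect
square on every side (`focalForm_side`). Conversely, the discriminant of the form on a chord `z₁z₂`
vanishes only if `h - z₁ - z₂` is on the circle (`focalForm_chord_discrim`). Two tangent chords from
`z₁` then force `z₁ + z₂ + z₃ = h`, which fixes the barycenter at `h / 3`. -/

/-! ### The focal conic inside the unit circle -/

/-- The conic with foci at the origin and at `(p, q)` and major axis of length `1`, for
`p ^ 2 + q ^ 2 < 1`, is the zero set of this polynomial. -/
def focalForm (p q x y : ℝ) : ℝ :=
  4 * (x ^ 2 + y ^ 2) - (1 - p ^ 2 - q ^ 2 + 2 * (x * p + y * q)) ^ 2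

theorem focalForm_centered (p q x y : ℝ) :
    focalForm p q x y = 4 * ((x - p / 2) ^ 2 + (y - q / 2) ^ 2)
      - 4 * ((x - p / 2) * p + (y - q / 2) * q) ^ 2 - (1 - p ^ 2 - q ^ 2) := by
  unfold focalForm; ring

/-- Cauchy–Schwarz with `|h| < 1`. It makes the quadratic part of the focal form positive definite,
so the conic is an ellipse. -/
theorem dot_sq_lt {p q x y : ℝ} (hf : p ^ 2 + q ^ 2 < 1) (h : x ≠ 0 ∨ y ≠ 0) :
    (x * p + y * q) ^ 2 < x ^ 2 + y ^ 2 := by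
  have h0 : 0 < x ^ 2 + y ^ 2 := by
    rcases h with h | h
    · have := pow_pos (abs_pos.2 h) 2
      rw [sq_abs] at this; positivity
    · have := pow_pos (abs_pos.2 h) 2
      rw [sq_abs] at this; positivity
  nlinarith [sq_nonneg (x * q - y * p), mul_pos h0 (sub_pos.2 hf)]

theorem sq_add_sq_lt_one_of_focalForm_eq_zero {p q x y : ℝ} (hf : p ^ 2 + q ^ 2 < 1)
    (h : focalForm p q x y = 0) : x ^ 2 + y ^ 2 < 1 := by
  by_contra! hr
  unfold focalForm at h
  set m := x * p + y * q with hm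
  have hcs : m ^ 2 ≤ (x ^ 2 + y ^ 2) * (p ^ 2 + q ^ 2) := by
    nlinarith [sq_nonneg (x * q - y * p)]
  obtain ⟨r, hr0, hr2⟩ : ∃ r : ℝ, 0 ≤ r ∧ r ^ 2 = x ^ 2 + y ^ 2 :=
    ⟨√(x ^ 2 + y ^ 2), Real.sqrt_nonneg _, Real.sq_sqrt (by positivity)⟩
  obtain ⟨s, hs0, hs2⟩ : ∃ s : ℝ, 0 ≤ s ∧ s ^ 2 = p ^ 2 + q ^ 2 :=
    ⟨√(p ^ 2 + q ^ 2), Real.sqrt_nonneg _, Real.sq_sqrt (by positivity)⟩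
  rw [← hr2, ← hs2, ← mul_pow] at hcs
  have hm' := abs_le_of_sq_le_sq' hcs (by positivity)
  have hr1 : 1 ≤ r := by nlinarith
  have hs1 : s < 1 := by nlinarith
  -- The form is a difference of squares; for `r ≥ 1 > s` and `|m| ≤ r * s` both factors are
  -- positive.
  have e : (2 * r - (1 - s ^ 2 + 2 * m)) * (2 * r + (1 - s ^ 2 + 2 * m)) = 0 := by
    rw [hs2]; linear_combination h + 4 * hr2
  have h1 : 0 < 2 * r - (1 - s ^ 2 + 2 * m) := by
    nlinarith [mul_nonneg (sub_nonneg.2 hr1) (sub_pos.2 hs1).le, pow_pos (sub_pos.2 hs1) 2]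
  have h2 : 0 < 2 * r + (1 - s ^ 2 + 2 * m) := by
    nlinarith [mul_nonneg (sub_nonneg.2 hr1) (sub_pos.2 hs1).le]
  exact (mul_pos h1 h2).ne' e

/-! ### Tangent chords and inscribed triangles -/

/-- The left side is a quarter of the discriminant of the form restricted to the chord; the last
factor on the right tests whether `h - z₁ - z₂` lies on the circle. -/
theorem focalForm_chord_discrim {p q x₁ y₁ x₂ y₂ : ℝ}
    (h₁ : x₁ ^ 2 + y₁ ^ 2 = 1) (h₂ : x₂ ^ 2 + y₂ ^ 2 = 1) :
    (4 * (x₁ * x₂ + y₁ * y₂) - (1 - p ^ 2 - q ^ 2 + 2 * (x₁ * p + y₁ * q))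
        * (1 - p ^ 2 - q ^ 2 + 2 * (x₂ * p + y₂ * q))) ^ 2
      - focalForm p q x₁ y₁ * focalForm p q x₂ y₂
    = - 4 * ((x₁ - x₂) ^ 2 + (y₁ - y₂) ^ 2) * (1 - p ^ 2 - q ^ 2)
        * ((x₁ + x₂ - p) ^ 2 + (y₁ + y₂ - q) ^ 2 - 1) := by
  -- The Gram determinant of three plane vectors `z₁, z₂, h` vanishes.
  have hgram : (x₁ * p + y₁ * q) ^ 2 + (x₂ * p + y₂ * q) ^ 2
      - 2 * (x₁ * x₂ + y₁ * y₂) * (x₁ * p + y₁ * q) * (x₂ * p + y₂ * q)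
      = (1 - (x₁ * x₂ + y₁ * y₂) ^ 2) * (p ^ 2 + q ^ 2) := by
    have e₁ : (x₁ * p + y₁ * q) ^ 2 * (x₂ ^ 2 + y₂ ^ 2) + (x₂ * p + y₂ * q) ^ 2 * (x₁ ^ 2 + y₁ ^ 2)
      - 2 * (x₁ * x₂ + y₁ * y₂) * (x₁ * p + y₁ * q) * (x₂ * p + y₂ * q)
      = ((x₁ ^ 2 + y₁ ^ 2) * (x₂ ^ 2 + y₂ ^ 2) - (x₁ * x₂ + y₁ * y₂) ^ 2) * (p ^ 2 + q ^ 2) := by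
      ring
    rw [h₁, h₂] at e₁
    linear_combination e₁
  have hd : (x₁ - x₂) ^ 2 + (y₁ - y₂) ^ 2 = 2 - 2 * (x₁ * x₂ + y₁ * y₂) := by
    linear_combination h₁ + h₂
  have hs : (x₁ + x₂ - p) ^ 2 + (y₁ + y₂ - q) ^ 2 = 2 + 2 * (x₁ * x₂ + y₁ * y₂)
      - 2 * ((x₁ * p + y₁ * q) + (x₂ * p + y₂ * q)) + (p ^ 2 + q ^ 2) := by
    linear_combination h₁ + h₂
  unfold focalForm
  rw [hd, hs, h₁, h₂]
  linear_combination 16 * hgram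

/-- A chord of the unit circle whose line meets the conic in exactly one point satisfies the
tangency condition: the third vertex `(p, q) - z₁ - z₂` lies on the circle. -/
theorem third_vertex_of_unique_root {p q x₁ y₁ x₂ y₂ : ℝ} (hf : p ^ 2 + q ^ 2 < 1)
    (h₁ : x₁ ^ 2 + y₁ ^ 2 = 1) (h₂ : x₂ ^ 2 + y₂ ^ 2 = 1) (hne : x₂ - x₁ ≠ 0 ∨ y₂ - y₁ ≠ 0)
    {t : ℝ} (ht : focalForm p q ((1 - t) * x₁ + t * x₂) ((1 - t) * y₁ + t * y₂) = 0)
    (huniq : ∀ s, focalForm p q ((1 - s) * x₁ + s * x₂) ((1 - s) * y₁ + s * y₂) = 0 → s = t) :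
    (x₁ + x₂ - p) ^ 2 + (y₁ + y₂ - q) ^ 2 = 1 := by
  have hlt := dot_sq_lt hf hne
  obtain ⟨B, hB⟩ : ∃ B, B = 4 * (x₁ * x₂ + y₁ * y₂) - (1 - p ^ 2 - q ^ 2 + 2 * (x₁ * p + y₁ * q))
        * (1 - p ^ 2 - q ^ 2 + 2 * (x₂ * p + y₂ * q)) := ⟨_, rfl⟩
  obtain ⟨g₁, hg₁⟩ : ∃ g, g = focalForm p q x₁ y₁ := ⟨_, rfl⟩
  obtain ⟨g₂, hg₂⟩ : ∃ g, g = focalForm p q x₂ y₂ := ⟨_, rfl⟩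
  have hq : ∀ s, focalForm p q ((1 - s) * x₁ + s * x₂) ((1 - s) * y₁ + s * y₂)
      = g₁ * (1 - s) ^ 2 + 2 * B * s * (1 - s) + g₂ * s ^ 2 := by
    intro s; rw [hB, hg₁, hg₂]; unfold focalForm; ring
  have hA : g₁ + g₂ - 2 * B
      = 4 * ((x₂ - x₁) ^ 2 + (y₂ - y₁) ^ 2 - ((x₂ - x₁) * p + (y₂ - y₁) * q) ^ 2) := by
    rw [hB, hg₁, hg₂]; unfold focalForm; ring
  have hApos : g₁ + g₂ - 2 * B ≠ 0 := by rw [hA]; linarith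
  rw [hq] at ht
  -- By Vieta this is the other root, so uniqueness makes `t` a double root.
  have hother : 2 * (g₁ - B) / (g₁ + g₂ - 2 * B) - t = t := by
    apply huniq
    rw [hq]
    field_simp
    linear_combination (g₁ + g₂ - 2 * B) ^ 2 * ht
  have hroot : g₁ - B = (g₁ + g₂ - 2 * B) * t := by
    field_simp at hother
    linear_combination hother / 2
  have hdisc : B ^ 2 - g₁ * g₂ = 0 := by
    have : (g₁ - B) ^ 2 - (g₁ + g₂ - 2 * B) * g₁ = 0 := by
      rw [hroot]
      linear_combination (-(g₁ + g₂ - 2 * B)) * ht - 2 * (g₁ + g₂ - 2 * B) * t * hroot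
    linear_combination this
  have hd := focalForm_chord_discrim (p := p) (q := q) h₁ h₂
  rw [← hB, ← hg₁, ← hg₂, hdisc] at hd
  have hdpos : 0 < (x₁ - x₂) ^ 2 + (y₁ - y₂) ^ 2 := by
    linarith [sq_nonneg ((x₂ - x₁) * p + (y₂ - y₁) * q)]
  have hepos : 0 < 1 - p ^ 2 - q ^ 2 := by linarith
  have := mul_pos hdpos hepos
  have h0 : (((x₁ - x₂) ^ 2 + (y₁ - y₂) ^ 2) * (1 - p ^ 2 - q ^ 2))
      * ((x₁ + x₂ - p) ^ 2 + (y₁ + y₂ - q) ^ 2 - 1) = 0 := by linear_combination (1 / 4) * hd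
  have := (mul_eq_zero.1 h0).resolve_left this.ne'
  linarith

/-- Both `z₂` and `z₃` lie on the unit circles about `0` and `h - z₁`. The two common points of
these circles are symmetric about the midpoint of the centers, so they add up to `h - z₁`. -/
theorem sum_eq_of_third_vertices {p q x₁ y₁ x₂ y₂ x₃ y₃ : ℝ} (hf : p ^ 2 + q ^ 2 < 1)
    (h₁ : x₁ ^ 2 + y₁ ^ 2 = 1) (h₂ : x₂ ^ 2 + y₂ ^ 2 = 1) (h₃ : x₃ ^ 2 + y₃ ^ 2 = 1)
    (hne : x₃ - x₂ ≠ 0 ∨ y₃ - y₂ ≠ 0)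
    (h₁₂ : (x₁ + x₂ - p) ^ 2 + (y₁ + y₂ - q) ^ 2 = 1)
    (h₁₃ : (x₁ + x₃ - p) ^ 2 + (y₁ + y₃ - q) ^ 2 = 1) :
    x₁ + x₂ + x₃ = p ∧ y₁ + y₂ + y₃ = q := by
  obtain ⟨m, hm⟩ : ∃ m, m = p - x₁ := ⟨_, rfl⟩
  obtain ⟨n, hn⟩ : ∃ n, n = q - y₁ := ⟨_, rfl⟩
  have hp : p = m + x₁ := by linarith
  have hq : q = n + y₁ := by linarith
  have hmn : 0 < m ^ 2 + n ^ 2 := by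
    by_contra! h
    have h1 : m = 0 := by nlinarith [sq_nonneg m, sq_nonneg n]
    have h2 : n = 0 := by nlinarith [sq_nonneg m, sq_nonneg n]
    rw [hp, hq, h1, h2] at hf
    linarith
  subst hp hq
  have d₂ : 2 * (x₂ * m + y₂ * n) = m ^ 2 + n ^ 2 := by linear_combination h₂ - h₁₂
  have d₃ : 2 * (x₃ * m + y₃ * n) = m ^ 2 + n ^ 2 := by linear_combination h₃ - h₁₃
  have o₁ : (x₃ - x₂) * m + (y₃ - y₂) * n = 0 := by linear_combination (d₃ - d₂) / 2
  have o₂ : (x₃ - x₂) * (x₂ + x₃) + (y₃ - y₂) * (y₂ + y₃) = 0 := by linear_combination h₃ - h₂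
  -- Both `z₂ + z₃` and `(m, n)` are orthogonal to `z₃ - z₂ ≠ 0`, hence parallel.
  have hdet : (x₂ + x₃) * n - (y₂ + y₃) * m = 0 := by
    rcases hne with h | h
    · apply mul_left_cancel₀ h
      linear_combination n * o₂ - (y₂ + y₃) * o₁
    · apply mul_left_cancel₀ h
      linear_combination (x₂ + x₃) * o₁ - m * o₂
  have hdot : (x₂ + x₃) * m + (y₂ + y₃) * n = m ^ 2 + n ^ 2 := by linear_combination (d₂ + d₃) / 2
  constructor
  · have : (m ^ 2 + n ^ 2) * (x₂ + x₃ - m) = 0 := by linear_combination m * hdot + n * hdet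
    have := (mul_eq_zero.1 this).resolve_left hmn.ne'
    linarith
  · have : (m ^ 2 + n ^ 2) * (y₂ + y₃ - n) = 0 := by linear_combination n * hdot - m * hdet
    have := (mul_eq_zero.1 this).resolve_left hmn.ne'
    linarith

/-- On the line through two vertices of a triangle inscribed in the unit circle with orthocenter
`(p, q)`, the focal form is a perfect square. -/
theorem focalForm_side {x₁ y₁ x₂ y₂ x₃ y₃ : ℝ}
    (h₁ : x₁ ^ 2 + y₁ ^ 2 = 1) (h₂ : x₂ ^ 2 + y₂ ^ 2 = 1) (h₃ : x₃ ^ 2 + y₃ ^ 2 = 1) (t : ℝ) :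
    focalForm (x₁ + x₂ + x₃) (y₁ + y₂ + y₃) ((1 - t) * x₁ + t * x₂) ((1 - t) * y₁ + t * y₂)
      = 4 * ((1 - t) * (x₂ * y₃ - y₂ * x₃) - t * (x₃ * y₁ - y₃ * x₁)) ^ 2 := by
  have hL : 1 - (x₁ + x₂ + x₃) ^ 2 - (y₁ + y₂ + y₃) ^ 2
      + 2 * (((1 - t) * x₁ + t * x₂) * (x₁ + x₂ + x₃) + ((1 - t) * y₁ + t * y₂) * (y₁ + y₂ + y₃))
      = -2 * (((1 - t) * x₂ + t * x₁) * x₃ + ((1 - t) * y₂ + t * y₁) * y₃) := by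
    linear_combination (1 - 2 * t) * h₁ - (1 - 2 * t) * h₂ - h₃
  -- Reflecting the chord in its midpoint preserves the distance to the center. For the reflected
  -- point `w` the form becomes `4 * (|w|² |z₃|² - (w · z₃)²)`, a squared cross product by
  -- Lagrange's identity.
  have hsw : ((1 - t) * x₁ + t * x₂) ^ 2 + ((1 - t) * y₁ + t * y₂) ^ 2
      = ((1 - t) * x₂ + t * x₁) ^ 2 + ((1 - t) * y₂ + t * y₁) ^ 2 := by
    linear_combination ((1 - t) ^ 2 - t ^ 2) * (h₁ - h₂)
  unfold focalForm
  rw [hL, hsw]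
  linear_combination (-4) * (((1 - t) * x₂ + t * x₁) ^ 2 + ((1 - t) * y₂ + t * y₁) ^ 2) * h₃

/-- A triangle inscribed in the unit circle with orthocenter inside the circle is acute, so the
circumcenter has barycentric coordinates of the same sign. -/
theorem cross_mul_cross_pos {x₁ y₁ x₂ y₂ x₃ y₃ : ℝ}
    (h₁ : x₁ ^ 2 + y₁ ^ 2 = 1) (h₂ : x₂ ^ 2 + y₂ ^ 2 = 1) (h₃ : x₃ ^ 2 + y₃ ^ 2 = 1)
    (hf : (x₁ + x₂ + x₃) ^ 2 + (y₁ + y₂ + y₃) ^ 2 < 1) :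
    0 < (x₂ * y₃ - y₂ * x₃) * (x₃ * y₁ - y₃ * x₁) := by
  have e : (x₂ * y₃ - y₂ * x₃) * (x₃ * y₁ - y₃ * x₁)
      = (x₂ * x₃ + y₂ * y₃) * (x₃ * x₁ + y₃ * y₁) - (x₁ * x₂ + y₁ * y₂) * (x₃ ^ 2 + y₃ ^ 2) := by
    ring
  rw [e, h₃]
  have a₁ : 0 ≤ 1 + (x₂ * x₃ + y₂ * y₃) := by nlinarith [sq_nonneg (x₂ + x₃), sq_nonneg (y₂ + y₃)]
  have a₂ : 0 ≤ 1 + (x₃ * x₁ + y₃ * y₁) := by nlinarith [sq_nonneg (x₁ + x₃), sq_nonneg (y₁ + y₃)]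
  -- `|h| < 1` says that the three pairwise dot products sum to less than `-1`, so the goal exceeds
  -- the product of `a₁` and `a₂`.
  nlinarith [mul_nonneg a₁ a₂]

theorem exists_inscribed_sum_eq {p q x₁ y₁ : ℝ} (hf : p ^ 2 + q ^ 2 < 1)
    (h₁ : x₁ ^ 2 + y₁ ^ 2 = 1) :
    ∃ x₂ y₂ x₃ y₃ : ℝ, x₂ ^ 2 + y₂ ^ 2 = 1 ∧ x₃ ^ 2 + y₃ ^ 2 = 1 ∧
      x₁ + x₂ + x₃ = p ∧ y₁ + y₂ + y₃ = q := by
  obtain ⟨m, hm⟩ : ∃ m, m = p - x₁ := ⟨_, rfl⟩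
  obtain ⟨n, hn⟩ : ∃ n, n = q - y₁ := ⟨_, rfl⟩
  have hp : p = m + x₁ := by linarith
  have hq : q = n + y₁ := by linarith
  have hmn : 0 < m ^ 2 + n ^ 2 := by
    by_contra! h
    have h1 : m = 0 := by nlinarith [sq_nonneg m, sq_nonneg n]
    have h2 : n = 0 := by nlinarith [sq_nonneg m, sq_nonneg n]
    rw [hp, hq, h1, h2] at hf
    linarith
  have hmn4 : m ^ 2 + n ^ 2 ≤ 4 := by
    rw [hm, hn]; nlinarith [sq_nonneg (p + x₁), sq_nonneg (q + y₁)]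
  -- The other two vertices are the intersections of the unit circles about `0` and `(m, n)`; `s`
  -- scales the normal `(-n, m)` to half their common chord.
  set s := √((1 - (m ^ 2 + n ^ 2) / 4) / (m ^ 2 + n ^ 2))
  have hs : s ^ 2 * (m ^ 2 + n ^ 2) = 1 - (m ^ 2 + n ^ 2) / 4 := by
    rw [Real.sq_sqrt (div_nonneg (by linarith) hmn.le)]
    field_simp
  refine ⟨m / 2 - s * n, n / 2 + s * m, m / 2 + s * n, n / 2 - s * m, ?_, ?_, ?_, ?_⟩
  · linear_combination hs
  · linear_combination hs
  · linarith
  · linarith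

/-! ### Transport to the original plane -/

/-- Spectral theorem: the axes are eigenvectors and the semi-axes are `1 / √λ`. -/
theorem exists_ellipse_eq_quadric (C : Plane) (T : Plane →ₗ[ℝ] Plane) (hT : T.IsSymmetric)
    (hpos : ∀ w, w ≠ 0 → 0 < inner ℝ (T w) w) :
    ∃ (v : OrthonormalBasis (Fin 2) ℝ Plane) (a' b' : ℝ), 0 < a' ∧ 0 < b' ∧
      ellipse C v a' b' = {P | inner ℝ (T (P - C)) (P - C) = 1} := by
  have hn : Module.finrank ℝ Plane = 2 := by simp
  set v := hT.eigenvectorBasis hn with hv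
  set l := hT.eigenvalues hn with hl
  have happ : ∀ i, T (v i) = l i • v i := fun i => by
    exact hT.apply_eigenvectorBasis hn i
  have hlpos : ∀ i, 0 < l i := fun i => by
    have := hpos (v i) (v.orthonormal.ne_zero i)
    rwa [happ, real_inner_smul_left, real_inner_self_eq_norm_sq, v.norm_eq_one, one_pow,
      mul_one] at this
  refine ⟨v, 1 / √(l 0), 1 / √(l 1), by have := hlpos 0; positivity,
    by have := hlpos 1; positivity, ?_⟩
  ext P
  have h : ∀ w, inner ℝ (T w) w
      = (inner ℝ (v 0) w / (1 / √(l 0))) ^ 2 + (inner ℝ (v 1) w / (1 / √(l 1))) ^ 2 := by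
    intro w
    rw [← v.sum_inner_mul_inner (T w) w, Fin.sum_univ_two, hT, hT, happ, happ,
      real_inner_smul_right, real_inner_smul_right, real_inner_comm (v 0) w,
      real_inner_comm (v 1) w, div_div_eq_mul_div, div_div_eq_mul_div, div_one, div_one, mul_pow,
      mul_pow, Real.sq_sqrt (hlpos 0).le, Real.sq_sqrt (hlpos 1).le]
    ring
  simp only [ellipse, Set.mem_ofPred_eq, h]

/-- Coordinate of `P` along `w` relative to the origin `O`, in units of `s`. -/
noncomputable def scaledCoord (O w : Plane) (s : ℝ) (P : Plane) : ℝ := inner ℝ w (P - O) / s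

theorem scaledCoord_lineMap (O w : Plane) (s : ℝ) (P Q : Plane) (t : ℝ) :
    scaledCoord O w s (AffineMap.lineMap P Q t)
      = (1 - t) * scaledCoord O w s P + t * scaledCoord O w s Q := by
  have : AffineMap.lineMap P Q t - O = (1 - t) • (P - O) + t • (Q - O) := by
    rw [AffineMap.lineMap_apply_module]; module
  rw [scaledCoord, this, inner_add_right, real_inner_smul_right, real_inner_smul_right]
  unfold scaledCoord; ring

section Frame

variable (O : Plane) (u : OrthonormalBasis (Fin 2) ℝ Plane) {a b : ℝ}

variable {O u} in
theorem mem_ellipse_iff {P : Plane} : P ∈ ellipse O u a b ↔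
    scaledCoord O (u 0) a P ^ 2 + scaledCoord O (u 1) b P ^ 2 = 1 := Iff.rfl

theorem eq_of_scaledCoord_eq (ha : a ≠ 0) (hb : b ≠ 0) {P Q : Plane}
    (h₀ : scaledCoord O (u 0) a P = scaledCoord O (u 0) a Q)
    (h₁ : scaledCoord O (u 1) b P = scaledCoord O (u 1) b Q) : P = Q := by
  unfold scaledCoord at h₀ h₁
  rw [div_left_inj' ha] at h₀
  rw [div_left_inj' hb] at h₁
  rw [← sub_left_inj (a := O)]
  apply u.repr.injective
  ext i
  simp only [u.repr_apply_apply]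
  fin_cases i
  · exact h₀
  · exact h₁

theorem exists_scaledCoord_eq (ha : a ≠ 0) (hb : b ≠ 0) (x y : ℝ) :
    ∃ P, scaledCoord O (u 0) a P = x ∧ scaledCoord O (u 1) b P = y := by
  have h01 : inner ℝ (u 0) (u 1) = 0 := u.inner_eq_zero (by decide)
  refine ⟨O + ((a * x) • u 0 + (b * y) • u 1), ?_, ?_⟩
  · simp [scaledCoord, inner_add_right, real_inner_smul_right, h01, ha]
  · simp [scaledCoord, inner_add_right, real_inner_smul_right, real_inner_comm (u 0) (u 1), h01, hb]

theorem exists_ellipse_eq_focalForm (ha : a ≠ 0) (hb : b ≠ 0) (C : Plane) {p q : ℝ}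
    (hp : p = 2 * scaledCoord O (u 0) a C) (hq : q = 2 * scaledCoord O (u 1) b C)
    (hf : p ^ 2 + q ^ 2 < 1) :
    ∃ (v : OrthonormalBasis (Fin 2) ℝ Plane) (a' b' : ℝ), 0 < a' ∧ 0 < b' ∧
      ∀ P, P ∈ ellipse C v a' b' ↔
        focalForm p q (scaledCoord O (u 0) a P) (scaledCoord O (u 1) b P) = 0 := by
  have he : 0 < 1 - p ^ 2 - q ^ 2 := by linarith
  -- Pairing with `n` gives the dot product with `h` in scaled coordinates, so `T` below is the
  -- normalized quadratic part of the centered focal form.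
  set n : Plane := (p / a) • u 0 + (q / b) • u 1 with hn
  let R : Plane → Plane →ₗ[ℝ] Plane := fun z => (innerSL ℝ z).toLinearMap.smulRight z
  have hR : ∀ z w w', inner ℝ (R z w) w' = inner ℝ z w * inner ℝ z w' := fun z w w' => by
    simp [R, real_inner_smul_left]
  let T : Plane →ₗ[ℝ] Plane := (4 / (1 - p ^ 2 - q ^ 2)) •
    ((1 / a ^ 2) • R (u 0) + (1 / b ^ 2) • R (u 1) - R n)
  have hTi : ∀ w w', inner ℝ (T w) w' = 4 / (1 - p ^ 2 - q ^ 2) *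
      (1 / a ^ 2 * (inner ℝ (u 0) w * inner ℝ (u 0) w')
        + 1 / b ^ 2 * (inner ℝ (u 1) w * inner ℝ (u 1) w') - inner ℝ n w * inner ℝ n w') := by
    intro w w'
    simp only [T, LinearMap.smul_apply, LinearMap.sub_apply, LinearMap.add_apply,
      real_inner_smul_left, inner_sub_left, inner_add_left, hR]
  have hT : T.IsSymmetric := fun w w' => by
    rw [real_inner_comm (T w') w, hTi, hTi]; ring
  have hquad : ∀ w, inner ℝ (T w) w = 4 / (1 - p ^ 2 - q ^ 2) *
      ((inner ℝ (u 0) w / a) ^ 2 + (inner ℝ (u 1) w / b) ^ 2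
        - (inner ℝ (u 0) w / a * p + inner ℝ (u 1) w / b * q) ^ 2) := by
    intro w
    rw [hTi, hn, inner_add_left, real_inner_smul_left, real_inner_smul_left]
    ring
  obtain ⟨v, a', b', ha', hb', hK⟩ := exists_ellipse_eq_quadric C T hT (by
    intro w hw
    rw [hquad]
    refine mul_pos (by positivity) (sub_pos.2 (dot_sq_lt hf ?_))
    by_contra! h
    apply hw
    apply eq_of_scaledCoord_eq 0 u ha hb
    · simpa [scaledCoord] using h.1
    · simpa [scaledCoord] using h.2)
  refine ⟨v, a', b', ha', hb', fun P => ?_⟩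
  have h0 : inner ℝ (u 0) (P - C) / a = scaledCoord O (u 0) a P - p / 2 := by
    rw [hp, scaledCoord, scaledCoord, ← sub_sub_sub_cancel_right P C O, inner_sub_right]; ring
  have h1 : inner ℝ (u 1) (P - C) / b = scaledCoord O (u 1) b P - q / 2 := by
    rw [hq, scaledCoord, scaledCoord, ← sub_sub_sub_cancel_right P C O, inner_sub_right]; ring
  rw [hK, Set.mem_ofPred_eq, hquad, h0, h1, focalForm_centered, sub_eq_zero,
    div_mul_eq_mul_div, div_eq_one_iff_eq he.ne', mul_sub]

theorem third_vertex_of_tangent (ha : a ≠ 0) (hb : b ≠ 0) {p q : ℝ} (hf : p ^ 2 + q ^ 2 < 1)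
    {K : Set Plane} (hK : ∀ P, P ∈ K ↔
      focalForm p q (scaledCoord O (u 0) a P) (scaledCoord O (u 1) b P) = 0)
    {P Q R : Plane} (hP : P ∈ ellipse O u a b) (hQ : Q ∈ ellipse O u a b) (hne : P ≠ Q)
    (h : (line[ℝ, P, Q] : Set Plane) ∩ K = {R}) :
    (scaledCoord O (u 0) a P + scaledCoord O (u 0) a Q - p) ^ 2
      + (scaledCoord O (u 1) b P + scaledCoord O (u 1) b Q - q) ^ 2 = 1 := by
  have hR : R ∈ (line[ℝ, P, Q] : Set Plane) ∩ K := h ▸ Set.mem_singleton R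
  obtain ⟨t, rfl⟩ := mem_affineSpan_pair_iff_exists_lineMap_eq.1 hR.1
  refine third_vertex_of_unique_root (t := t) hf hP hQ ?_ ?_ ?_
  · by_contra! hc
    exact hne (eq_of_scaledCoord_eq O u ha hb (by linarith [hc.1]) (by linarith [hc.2]))
  · rw [← scaledCoord_lineMap, ← scaledCoord_lineMap]
    exact (hK _).1 hR.2
  · intro s hs
    rw [← scaledCoord_lineMap, ← scaledCoord_lineMap, ← hK] at hs
    have : AffineMap.lineMap P Q s ∈ (line[ℝ, P, Q] : Set Plane) ∩ K :=
      ⟨AffineMap.lineMap_mem_affineSpan_pair _ _ _, hs⟩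
    rw [h] at this
    exact AffineMap.lineMap_injective ℝ hne this

/-- Along the side the form is the square of an affine function, whose only zero is `c / (c + d)`;
acuteness gives `c` and `d` the same sign, placing it strictly between the vertices. -/
theorem exists_tangent_point {p q : ℝ} (hf : p ^ 2 + q ^ 2 < 1)
    {K : Set Plane} (hK : ∀ P, P ∈ K ↔
      focalForm p q (scaledCoord O (u 0) a P) (scaledCoord O (u 1) b P) = 0)
    {P Q S : Plane} (hP : P ∈ ellipse O u a b) (hQ : Q ∈ ellipse O u a b)
    (hS : S ∈ ellipse O u a b)
    (hx : scaledCoord O (u 0) a P + scaledCoord O (u 0) a Q + scaledCoord O (u 0) a S = p)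
    (hy : scaledCoord O (u 1) b P + scaledCoord O (u 1) b Q + scaledCoord O (u 1) b S = q) :
    ∃ R ∈ openSegment ℝ P Q, (line[ℝ, P, Q] : Set Plane) ∩ K = {R} := by
  subst hx hy
  rw [mem_ellipse_iff] at hP hQ hS
  have hpos := cross_mul_cross_pos hP hQ hS hf
  have hform := focalForm_side hP hQ hS
  simp only [← scaledCoord_lineMap] at hform
  generalize scaledCoord O (u 0) a Q * scaledCoord O (u 1) b S
    - scaledCoord O (u 1) b Q * scaledCoord O (u 0) a S = c at hpos hform
  generalize scaledCoord O (u 0) a S * scaledCoord O (u 1) b P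
    - scaledCoord O (u 1) b S * scaledCoord O (u 0) a P = d at hpos hform
  have hcd : c + d ≠ 0 := by
    intro h
    rw [show d = -c by linarith] at hpos
    nlinarith [sq_nonneg c]
  have hroot : ∀ t, AffineMap.lineMap P Q t ∈ K ↔ t = c / (c + d) := by
    intro t
    rw [hK, hform, eq_div_iff hcd]
    constructor
    · intro h
      have := pow_eq_zero_iff (two_ne_zero) |>.1 ((mul_eq_zero.1 h).resolve_left (by norm_num))
      linarith
    · intro h
      rw [show (1 - t) * c - t * d = 0 by linarith]; norm_num
  have hIoo : c / (c + d) ∈ Set.Ioo (0 : ℝ) 1 := by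
    have e₁ : c / (c + d) = (c ^ 2 + c * d) / (c + d) ^ 2 := by field_simp
    have e₂ : 1 - c / (c + d) = (d ^ 2 + c * d) / (c + d) ^ 2 := by field_simp; ring
    have s₁ : 0 < c / (c + d) := by rw [e₁]; positivity
    have s₂ : 0 < 1 - c / (c + d) := by rw [e₂]; positivity
    exact ⟨s₁, by linarith⟩
  refine ⟨AffineMap.lineMap P Q (c / (c + d)), ?_, ?_⟩
  · rw [openSegment_eq_image_lineMap]
    exact Set.mem_image_of_mem _ hIoo
  · ext R
    constructor
    · rintro ⟨hR, hRK⟩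
      obtain ⟨t, rfl⟩ := mem_affineSpan_pair_iff_exists_lineMap_eq.1 hR
      rw [(hroot t).1 hRK, Set.mem_singleton_iff]
    · rintro rfl
      exact ⟨AffineMap.lineMap_mem_affineSpan_pair _ _ _, (hroot _).2 rfl⟩

theorem scaledCoord_smul_vadd (w : Plane) (s r : ℝ) (d P : Plane) :
    scaledCoord O w s (r • d +ᵥ P) = r * (inner ℝ w d / s) + scaledCoord O w s P := by
  rw [scaledCoord, scaledCoord, vadd_eq_add, add_sub_assoc, inner_add_right, real_inner_smul_right]
  ring

theorem affineIndependent_of_sum_scaledCoord {p q : ℝ} (hf : p ^ 2 + q ^ 2 < 1)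
    {P Q S : Plane} (hP : P ∈ ellipse O u a b) (hQ : Q ∈ ellipse O u a b)
    (hS : S ∈ ellipse O u a b)
    (hx : scaledCoord O (u 0) a P + scaledCoord O (u 0) a Q + scaledCoord O (u 0) a S = p)
    (hy : scaledCoord O (u 1) b P + scaledCoord O (u 1) b Q + scaledCoord O (u 1) b S = q) :
    AffineIndependent ℝ ![P, Q, S] := by
  subst hx hy
  rw [affineIndependent_iff_not_collinear_set, collinear_iff_exists_forall_eq_smul_vadd]
  rintro ⟨Z, d, h⟩
  rw [mem_ellipse_iff] at hP hQ hS
  have c₁ := cross_mul_cross_pos hP hQ hS hf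
  have c₂ := cross_mul_cross_pos hQ hS hP (by convert hf using 3 <;> ring)
  have hdet : (scaledCoord O (u 0) a P * scaledCoord O (u 1) b Q
      - scaledCoord O (u 1) b P * scaledCoord O (u 0) a Q)
      + (scaledCoord O (u 0) a Q * scaledCoord O (u 1) b S
      - scaledCoord O (u 1) b Q * scaledCoord O (u 0) a S)
      + (scaledCoord O (u 0) a S * scaledCoord O (u 1) b P
      - scaledCoord O (u 1) b S * scaledCoord O (u 0) a P) = 0 := by
    obtain ⟨r₁, h₁⟩ := h P (by simp)
    obtain ⟨r₂, h₂⟩ := h Q (by simp)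
    obtain ⟨r₃, h₃⟩ := h S (by simp)
    rw [h₁, h₂, h₃]
    simp only [scaledCoord_smul_vadd]
    ring
  generalize scaledCoord O (u 0) a P * scaledCoord O (u 1) b Q
      - scaledCoord O (u 1) b P * scaledCoord O (u 0) a Q = e at *
  generalize scaledCoord O (u 0) a Q * scaledCoord O (u 1) b S
      - scaledCoord O (u 1) b Q * scaledCoord O (u 0) a S = c at *
  generalize scaledCoord O (u 0) a S * scaledCoord O (u 1) b P
      - scaledCoord O (u 1) b S * scaledCoord O (u 0) a P = d at *
  -- Collinearity kills the signed area `e + c + d`, yet `c * d` and `d * e` are positive.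
  have : d * (e + c + d) = 0 := by rw [hdet, mul_zero]
  nlinarith [sq_nonneg d]

theorem centroid_eq_of_sum_scaledCoord (ha : a ≠ 0) (hb : b ≠ 0) {C : Plane}
    (T : Affine.Triangle ℝ Plane)
    (hx : scaledCoord O (u 0) a (T.points 0) + scaledCoord O (u 0) a (T.points 1)
      + scaledCoord O (u 0) a (T.points 2) = 2 * scaledCoord O (u 0) a C)
    (hy : scaledCoord O (u 1) b (T.points 0) + scaledCoord O (u 1) b (T.points 1)
      + scaledCoord O (u 1) b (T.points 2) = 2 * scaledCoord O (u 1) b C) :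
    T.centroid = AffineMap.lineMap O C (2 / 3 : ℝ) := by
  have hc : ∀ w s, scaledCoord O w s T.centroid = (scaledCoord O w s (T.points 0)
      + scaledCoord O w s (T.points 1) + scaledCoord O w s (T.points 2)) / 3 := by
    intro w s
    have := T.centroid_vsub_eq O
    rw [scaledCoord, ← vsub_eq_sub, this, Fin.sum_univ_three, real_inner_smul_right,
      inner_add_right, inner_add_right]
    unfold scaledCoord
    simp only [vsub_eq_sub]
    push_cast
    ring
  have hO : ∀ w s, scaledCoord O w s O = 0 := fun w s => by simp [scaledCoord]
  apply eq_of_scaledCoord_eq O u ha hb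
  · rw [hc, hx, scaledCoord_lineMap, hO]; ring
  · rw [hc, hy, scaledCoord_lineMap, hO]; ring

end Frame

/-! ### The Poncelet family -/

theorem mainTheorem4 (O : Plane) (u : OrthonormalBasis (Fin 2) ℝ Plane) (a b : ℝ)
    (ha : 0 < a) (hb : 0 < b) (Oc : Plane) (hOc : Oc ∈ ellipseInterior O u (a / 2) (b / 2)) :
    ∃ (v : OrthonormalBasis (Fin 2) ℝ Plane) (a' b' : ℝ), 0 < a' ∧ 0 < b' ∧
      ellipse Oc v a' b' ⊆ ellipseInterior O u a b ∧
      AdmitsPonceletTriangles (ellipse O u a b) (ellipse Oc v a' b') ∧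
      ∃ G ∈ line[ℝ, O, Oc],
        ∀ T ∈ ponceletTriangles (ellipse O u a b) (ellipse Oc v a' b'), T.centroid = G := by
  -- The factor `2` makes `Oc` the midpoint of the foci `0` and `h`; the half-size ellipse then
  -- becomes the condition `|h| < 1`.
  obtain ⟨p, hp⟩ : ∃ p, p = 2 * scaledCoord O (u 0) a Oc := ⟨_, rfl⟩
  obtain ⟨q, hq⟩ : ∃ q, q = 2 * scaledCoord O (u 1) b Oc := ⟨_, rfl⟩
  have hf : p ^ 2 + q ^ 2 < 1 := by
    have h : (inner ℝ (u 0) (Oc - O) / (a / 2)) ^ 2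
      + (inner ℝ (u 1) (Oc - O) / (b / 2)) ^ 2 < 1 := hOc
    rw [hp, hq, scaledCoord, scaledCoord]
    convert h using 3 <;> field_simp
  have ha' := ha.ne'
  have hb' := hb.ne'
  obtain ⟨v, a', b', hpa, hpb, hK⟩ := exists_ellipse_eq_focalForm O u ha' hb' Oc hp hq hf
  -- The barycenter `h / 3` is two thirds of the way from `O` to `Oc = h / 2`.
  refine ⟨v, a', b', hpa, hpb, fun P hP => sq_add_sq_lt_one_of_focalForm_eq_zero hf ((hK P).1 hP),
    ?_, AffineMap.lineMap O Oc (2 / 3 : ℝ), AffineMap.lineMap_mem_affineSpan_pair _ _ _, ?_⟩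
  · intro P hP
    obtain ⟨x₂, y₂, x₃, y₃, h₂, h₃, hx, hy⟩ := exists_inscribed_sum_eq hf (mem_ellipse_iff.1 hP)
    obtain ⟨Q, rfl, rfl⟩ := exists_scaledCoord_eq O u ha' hb' x₂ y₂
    obtain ⟨S, rfl, rfl⟩ := exists_scaledCoord_eq O u ha' hb' x₃ y₃
    refine ⟨⟨![P, Q, S], affineIndependent_of_sum_scaledCoord O u hf hP h₂ h₃ hx hy⟩,
      ⟨?_, ?_⟩, 0, rfl⟩
    · intro i
      fin_cases i
      · exact hP
      · exact h₂
      · exact h₃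
    · intro i j hij
      fin_cases i <;> fin_cases j
      · exact absurd rfl hij
      · exact exists_tangent_point O u (P := P) (Q := Q) (S := S) hf hK hP h₂ h₃
          (by linarith) (by linarith)
      · exact exists_tangent_point O u (P := P) (Q := S) (S := Q) hf hK hP h₃ h₂
          (by linarith) (by linarith)
      · exact exists_tangent_point O u (P := Q) (Q := P) (S := S) hf hK h₂ hP h₃
          (by linarith) (by linarith)
      · exact absurd rfl hij
      · exact exists_tangent_point O u (P := Q) (Q := S) (S := P) hf hK h₂ h₃ hP
          (by linarith) (by linarith)
      · exact exists_tangent_point O u (P := S) (Q := P) (S := Q) hf hK h₃ hP h₂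
          (by linarith) (by linarith)
      · exact exists_tangent_point O u (P := S) (Q := Q) (S := P) hf hK h₃ h₂ hP
          (by linarith) (by linarith)
      · exact absurd rfl hij
  · rintro T ⟨hE, htan⟩
    have hinj := T.independent.injective
    have hthird := fun (j : Fin 3) (hj : j ≠ 0) =>
      let ⟨_, _, h⟩ := htan 0 j hj.symm
      third_vertex_of_tangent O u ha' hb' hf hK (hE 0) (hE j) (hinj.ne hj.symm) h
    have hsum := sum_eq_of_third_vertices hf (mem_ellipse_iff.1 (hE 0))
      (mem_ellipse_iff.1 (hE 1)) (mem_ellipse_iff.1 (hE 2)) (by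
      by_contra! hc
      have := eq_of_scaledCoord_eq O u ha' hb' (P := T.points 2) (Q := T.points 1)
        (sub_eq_zero.1 hc.1) (sub_eq_zero.1 hc.2)
      exact absurd (hinj this) (by decide)) (hthird 1 (by decide)) (hthird 2 (by decide))
    exact centroid_eq_of_sum_scaledCoord O u ha' hb' T (hsum.1.trans hp) (hsum.2.trans hq)
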